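/- Let $M$ be a closed manifold, i.e. a compact connected manifold without boundary, endowed with a Riemannian metric with norm $\|\cdot\|$ and induced distance $d$. Let $V$ be a $C^1$ vector field on $M$, and let $V_t(x)$, $t\in\mathbb{R}$, be the solution of $\dot x=V(x)$ with initial condition $x$; for $I\subset\mathbb{R}$ write $V_I(x)=\{V_\tau(x):\tau\in I\}$. A set $\Lambda\subset M$ is invariant if $V_t(\Lambda)=\Lambda$ for every $t\in\mathbb{R}$. We say that $V$ is k*-expansive on $\Lambda$ if for every $\epsilon>0$ there is $\delta>0$ such that whenever $x,y\in\Lambda$ and an increasing homeomorphism $s:\mathbb{R}\to\mathbb{R}$ with $s(0)=0$ satisfy $d(V_t(x),V_{s(t)}(y))\le\delta$ for every $t\in\mathbb{R}$, one has $V_{s(t_0)}(y)\in V_{[t_0-\epsilon,t_0+\epsilon]}(x)$ for some $t_0\in\mathbb{R}$. We say that $V$ is rescaling expansive on $\Lambda$ if for every $\epsilon>0$ there is $\delta>0$ such that whenever $x,y\in\Lambda$ and an increasing homeomorphism $s:\mathbb{R}\to\mathbb{R}$ satisfy $d(V_t(x),V_{s(t)}(y))\le\delta\|V(V_t(x))\|$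 for every $t\in\mathbb{R}$, one has $V_{s(0)}(y)\in V_{[-\epsilon,\epsilon]}(x)$. Theorem. If $V$ is k*-expansive on a compact invariant set $\Lambda\subset M$, then $V$ is rescaling expansive on $\Lambda$. -/

import Mathlib

open Set Manifold Bundle
open scoped ContDiff

noncomputable section

/-- The flow of the vector field `V`: `vectorFieldFlow V t x` is the value at time `t` of the global
integral curve of `V` with initial condition `x`. For a `C^1` vector field on a closed manifold
this curve exists and is unique for every `x`; where no such curve exists the value is `x`. -/
def vectorFieldFlow {E : Type*} [NormedAddCommGroup E] [NormedSpace ℝ E]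
    {M : Type*} [TopologicalSpace M] [ChartedSpace E M]
    (V : (x : M) → TangentSpace 𝓘(ℝ, E) x) (t : ℝ) (x : M) : M :=
  open Classical in
  if h : ∃ γ : ℝ → M, γ 0 = x ∧ IsMIntegralCurve (I := 𝓘(ℝ, E)) γ V then h.choose t else x

/-- `Λ` is invariant under `V`: `V_t(Λ) = Λ` for every real `t`. -/
def IsFlowInvariant {E : Type*} [NormedAddCommGroup E] [NormedSpace ℝ E]
    {M : Type*} [TopologicalSpace M] [ChartedSpace E M]
    (V : (x : M) → TangentSpace 𝓘(ℝ, E) x) (Λ : Set M) : Prop :=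
  ∀ t : ℝ, vectorFieldFlow V t '' Λ = Λ

/-- k*-expansivity of `V` on `Λ`. Increasing homeomorphisms of the line are the strictly monotone
ones. -/
def KStarExpansiveOn {E : Type*} [NormedAddCommGroup E] [NormedSpace ℝ E]
    {M : Type*} [MetricSpace M] [ChartedSpace E M]
    (V : (x : M) → TangentSpace 𝓘(ℝ, E) x) (Λ : Set M) : Prop :=
  ∀ ε : ℝ, 0 < ε → ∃ δ : ℝ, 0 < δ ∧
    ∀ x ∈ Λ, ∀ y ∈ Λ, ∀ s : ℝ ≃ₜ ℝ, StrictMono s → s 0 = 0 →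
      (∀ t : ℝ, dist (vectorFieldFlow V t x) (vectorFieldFlow V (s t) y) ≤ δ) →
      ∃ t₀ : ℝ, vectorFieldFlow V (s t₀) y ∈
        (fun τ : ℝ => vectorFieldFlow V τ x) '' Icc (t₀ - ε) (t₀ + ε)

/-- Rescaling expansivity of `V` on `Λ`; `‖·‖` is the norm of the Riemannian metric. -/
def RescalingExpansiveOn {E : Type*} [NormedAddCommGroup E] [NormedSpace ℝ E]
    {M : Type*} [MetricSpace M] [ChartedSpace E M]
    [RiemannianBundle (fun x : M => TangentSpace 𝓘(ℝ, E) x)]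
    (V : (x : M) → TangentSpace 𝓘(ℝ, E) x) (Λ : Set M) : Prop :=
  ∀ ε : ℝ, 0 < ε → ∃ δ : ℝ, 0 < δ ∧
    ∀ x ∈ Λ, ∀ y ∈ Λ, ∀ s : ℝ ≃ₜ ℝ, StrictMono s →
      (∀ t : ℝ, dist (vectorFieldFlow V t x) (vectorFieldFlow V (s t) y) ≤
        δ * ‖V (vectorFieldFlow V t x)‖) →
      vectorFieldFlow V (s 0) y ∈ (fun τ : ℝ => vectorFieldFlow V τ x) '' Icc (-ε) ε

end

open scoped Topology NNReal ENNReal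
open MeasureTheory

/-- Near a point where a time-independent vector field is `C^1`, solutions exist for a uniform time,
stay in a prescribed neighborhood, and are displaced at a rate at least half the initial speed. -/
theorem ContDiffAt.exists_forall_ball_exists_hasDerivAt_displacement {E : Type*}
    [NormedAddCommGroup E] [NormedSpace ℝ E] [CompleteSpace E] {v : E → E} {x₀ : E}
    (hv : ContDiffAt ℝ 1 v x₀) {S : Set E} (hS : S ∈ 𝓝 x₀) :
    ∃ r > (0 : ℝ), ∃ τ > (0 : ℝ), ∀ z ∈ Metric.ball x₀ r, ∃ f : ℝ → E, f 0 = z ∧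
      ∀ t ∈ Ioo (-τ) τ, HasDerivAt f (v (f t)) t ∧ f t ∈ S ∧ |t| * ‖v z‖ ≤ 2 * ‖f t - z‖ := by
  obtain ⟨ε, hε, a, r, L, K, hr, hpl⟩ := IsPicardLindelof.of_contDiffAt_one hv
  obtain ⟨ρ, hρ, hρS⟩ := Metric.nhds_basis_closedBall.mem_iff.1 hS
  have ha : 0 < a := by
    have h := (hpl 0).mul_max_le
    have hL : (0 : ℝ) ≤ L * max (0 + ε - 0) (0 - (0 - ε)) :=
      mul_nonneg L.2 (le_max_of_le_left (by linarith))
    have : (0 : ℝ) < a := by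
      have : (0 : ℝ) < r := hr
      simp only at h
      linarith
    exact this
  set a' : ℝ≥0 := min a ⟨ρ, hρ.le⟩ with ha'
  have ha'0 : 0 < a' := lt_min ha hρ
  obtain ⟨ε', hε', hpl'⟩ := (hpl 0).exists_shrink_radius hε (a' := a') (r' := a' / 2)
    (min_le_left _ _) (NNReal.half_lt_self ha'0.ne')
  have haS : Metric.closedBall x₀ (a' : ℝ) ⊆ S :=
    (Metric.closedBall_subset_closedBall (by exact_mod_cast (min_le_right a ⟨ρ, hρ.le⟩))).trans hρS
  refine ⟨(a' / 2 : ℝ≥0), by exact_mod_cast half_pos ha'0, min ε' (1 / (4 * (K + 1))),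
    lt_min hε' (by positivity), fun z hz ↦ ?_⟩
  have hz' := Metric.ball_subset_closedBall hz
  obtain ⟨α, hα⟩ := ODE.FunSpace.exists_isFixedPt_next hpl' hz'
  have hder : ∀ t ∈ Icc (0 - ε') (0 + ε'),
      HasDerivWithinAt α.compProj (v (α.compProj t)) (Icc (0 - ε') (0 + ε')) t := by
    intro t ht
    apply ODE.hasDerivWithinAt_picard_Icc (f := fun _ ↦ v)
      (show (0 : ℝ) ∈ Icc (0 - ε') (0 + ε') by constructor <;> linarith)
      hpl'.continuousOn_uncurry
      α.continuous_compProj.continuousOn (fun _ _ ↦ α.compProj_mem_closedBall hpl'.mul_max_le)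
      z ht |>.congr_of_mem _ ht
    intro t' ht'
    nth_rw 1 [← hα]
    rw [ODE.FunSpace.compProj_of_mem ht', ODE.FunSpace.next_apply]
  have h0 : α.compProj 0 = z := by
    have h := ODE.FunSpace.compProj_val (α := α) (t := ⟨0, by constructor <;> linarith⟩)
    rw [h, ← hα, ODE.FunSpace.next_apply₀]
  have hmem (t : ℝ) : α.compProj t ∈ Metric.closedBall x₀ (a' : ℝ) :=
    α.compProj_mem_closedBall hpl'.mul_max_le
  have hlip : LipschitzOnWith K v (Metric.closedBall x₀ a') :=
    hpl'.lipschitzOnWith 0 (by constructor <;> linarith)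
  refine ⟨α.compProj, h0, fun t ht ↦ ?_⟩
  have htε : |t| < ε' := (abs_lt.2 ht).trans_le (min_le_left _ _)
  have htK : K * |t| ≤ 1 / 4 := by
    have h1 : |t| < 1 / (4 * (K + 1)) := (abs_lt.2 ht).trans_le (min_le_right _ _)
    have hK : (0 : ℝ) ≤ K := K.2
    rw [lt_div_iff₀ (by positivity)] at h1
    nlinarith [abs_nonneg t]
  have hder' (s : ℝ) (hs : |s| < ε') : HasDerivAt α.compProj (v (α.compProj s)) s := by
    obtain ⟨h1, h2⟩ := abs_lt.1 hs
    exact (hder s ⟨by linarith, by linarith⟩).hasDerivAt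
      (Icc_mem_nhds (by linarith) (by linarith))
  refine ⟨hder' t htε, haS (hmem t), ?_⟩
  have hseg (s : ℝ) (hs : s ∈ uIcc 0 t) : |s| ≤ |t| := by
    simpa using abs_sub_left_of_mem_uIcc hs
  obtain ⟨m, hm, hmax⟩ := isCompact_uIcc.exists_isMaxOn (nonempty_uIcc (a := (0 : ℝ)) (b := t))
    (f := fun s ↦ ‖α.compProj s - z‖)
    (α.continuous_compProj.sub continuous_const).norm.continuousOn
  have hmvt (s : ℝ) (hs : s ∈ uIcc 0 t) :
      ‖α.compProj s - z - s • v z‖ ≤ K * ‖α.compProj m - z‖ * |s| := by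
    have := (convex_uIcc 0 t).norm_image_sub_le_of_norm_hasDerivWithin_le
      (f := fun s ↦ α.compProj s - s • v z) (f' := fun s ↦ v (α.compProj s) - v z)
      (C := K * ‖α.compProj m - z‖) (x := 0) (y := s) (fun s hs ↦ ?_) (fun s hs ↦ ?_)
      left_mem_uIcc hs
    · simpa only [h0, zero_smul, sub_zero, sub_right_comm, Real.norm_eq_abs] using this
    · have := ((hasDerivAt_id s).smul_const (v z))
      simp only [one_smul] at this
      exact ((hder' s ((hseg s hs).trans_lt htε)).sub this).hasDerivWithinAt
    · refine (hlip.norm_sub_le (hmem s) (Metric.closedBall_subset_closedBall ?_ hz')).trans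
        (mul_le_mul_of_nonneg_left (hmax hs) K.2)
      push_cast; linarith [a'.2]
  set D := ‖α.compProj m - z‖
  have hD : 0 ≤ D := norm_nonneg _
  have hDt : D ≤ 2 * (|t| * ‖v z‖) := by
    have h1 := hmvt m hm
    have h2 : D ≤ ‖α.compProj m - z - m • v z‖ + ‖m • v z‖ := by
      simpa only [sub_add_cancel] using norm_add_le (α.compProj m - z - m • v z) (m • v z)
    rw [norm_smul, Real.norm_eq_abs] at h2
    have h3 := hseg m hm
    have h4 : K * D * |m| ≤ K * |t| * D := by
      nlinarith [mul_le_mul_of_nonneg_left h3 (mul_nonneg K.2 hD : (0:ℝ) ≤ K * D)]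
    have h5 : K * |t| * D ≤ 1 / 4 * D := by gcongr
    have h6 : |m| * ‖v z‖ ≤ |t| * ‖v z‖ := by gcongr
    nlinarith
  have h1 := hmvt t right_mem_uIcc
  have h2 : ‖t • v z‖ ≤ ‖α.compProj t - z‖ + ‖α.compProj t - z - t • v z‖ := by
    simpa using norm_sub_le (α.compProj t - z) (α.compProj t - z - t • v z)
  rw [norm_smul, Real.norm_eq_abs] at h2
  have h5 : K * |t| * D ≤ 1 / 4 * D := by gcongr
  nlinarith

section ChartDistance

variable {E : Type*} [NormedAddCommGroup E] [NormedSpace ℝ E]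
  {H : Type*} [TopologicalSpace H] (I : ModelWithCorners ℝ E H)
  {M : Type*}

/-- Along a `C^1` path on which the trivialization of the tangent bundle is bounded by `C`, the
displacement in the corresponding chart is at most `C` times the length of the path. -/
theorem enorm_extChartAt_sub_le_pathELength [TopologicalSpace M] [ChartedSpace H M]
    [RiemannianBundle (fun x : M => TangentSpace I x)]
    [IsManifold I 1 M] [IsContinuousRiemannianBundle E (fun x : M => TangentSpace I x)]
    (x : M) {C : ℝ≥0} {γ : ℝ → M} (hγ : ContMDiff 𝓘(ℝ, ℝ) I 1 γ)
    (hsource : ∀ t ∈ Icc (0 : ℝ) 1, γ t ∈ (chartAt H x).source)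
    (hC : ∀ t ∈ Icc (0 : ℝ) 1, ‖(trivializationAt E (fun x : M => TangentSpace I x)
      x).continuousLinearMapAt ℝ (γ t)‖ₑ ≤ C) :
    ‖extChartAt I x (γ 1) - extChartAt I x (γ 0)‖ₑ ≤ C * pathELength I γ 0 1 := by
  let γ' := extChartAt I x ∘ γ
  have hγ' : ContMDiffOn 𝓘(ℝ, ℝ) 𝓘(ℝ, E) 1 γ' (Icc 0 1) :=
    contMDiffOn_extChartAt.comp (I' := I) (t := (chartAt H x).source) hγ.contMDiffOn hsource
  have hderiv (t : ℝ) (ht : t ∈ Icc (0 : ℝ) 1) : derivWithin γ' (Icc 0 1) t =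
      (trivializationAt E (fun x : M => TangentSpace I x) x).continuousLinearMapAt ℝ (γ t)
        (mfderivWithin 𝓘(ℝ, ℝ) I γ (Icc 0 1) t 1) := by
    have h1 : mfderivWithin 𝓘(ℝ, ℝ) 𝓘(ℝ, E) γ' (Icc 0 1) t =
        (mfderiv I 𝓘(ℝ, E) (extChartAt I x) (γ t)) ∘L
          (mfderivWithin 𝓘(ℝ, ℝ) I γ (Icc 0 1) t) := by
      apply mfderiv_comp_mfderivWithin
      · exact mdifferentiableAt_extChartAt (hsource t ht)
      · exact (hγ.mdifferentiable one_ne_zero).mdifferentiableOn _ ht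
      · rw [uniqueMDiffWithinAt_iff_uniqueDiffWithinAt]
        exact uniqueDiffOn_Icc zero_lt_one _ ht
    have h2 : mfderivWithin 𝓘(ℝ, ℝ) 𝓘(ℝ, E) γ' (Icc 0 1) t 1 =
        (mfderiv I 𝓘(ℝ, E) (extChartAt I x) (γ t))
          (mfderivWithin 𝓘(ℝ, ℝ) I γ (Icc 0 1) t 1) := congr($h1 1)
    rw [mfderivWithin_eq_fderivWithin] at h2
    rw [← fderivWithin_derivWithin, TangentBundle.continuousLinearMapAt_trivializationAt
      (hsource t ht)]
    exact h2
  calc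
    ‖γ' 1 - γ' 0‖ₑ ≤ ∫⁻ t in Icc 0 1, ‖derivWithin γ' (Icc 0 1) t‖ₑ := by
      apply enorm_sub_le_lintegral_derivWithin_Icc_of_contDiffOn_Icc _ zero_le_one
      rwa [← contMDiffOn_iff_contDiffOn]
    _ ≤ ∫⁻ t in Icc 0 1, C * ‖mfderivWithin 𝓘(ℝ, ℝ) I γ (Icc 0 1) t 1‖ₑ := by
      apply setLIntegral_mono' measurableSet_Icc (fun t ht ↦ ?_)
      rw [hderiv t ht]
      apply (ContinuousLinearMap.le_opENorm _ _).trans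
      gcongr
      exact hC t ht
    _ = C * pathELength I γ 0 1 := by
      rw [lintegral_const_mul' _ _ ENNReal.coe_ne_top, pathELength_eq_lintegral_mfderivWithin_Icc]

/-- Around every point, the extended chart is Lipschitz for the Riemannian distance. -/
theorem exists_ball_norm_extChartAt_sub_le_dist [MetricSpace M] [ChartedSpace H M]
    [RiemannianBundle (fun x : M => TangentSpace I x)]
    [IsManifold I 1 M] [IsContinuousRiemannianBundle E (fun x : M => TangentSpace I x)]
    [IsRiemannianManifold I M] (x : M) :
    ∃ C > (0 : ℝ), ∃ r > (0 : ℝ), ∀ y ∈ Metric.ball x r, ∀ z ∈ Metric.ball x r,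
      ‖extChartAt I x z - extChartAt I x y‖ ≤ C * dist y z := by
  obtain ⟨C, C_pos, hC⟩ := eventually_norm_trivializationAt_lt E
    (fun x : M => TangentSpace I x) x
  lift C to ℝ≥0 using C_pos.le
  obtain ⟨R, hR, hball⟩ := Metric.mem_nhds_iff.1
    (Filter.inter_mem hC (chart_source_mem_nhds H x))
  have hC0 : (0 : ℝ) < C := C_pos
  refine ⟨C, hC0, R / 4, by positivity, fun y hy z hz ↦ ?_⟩
  rw [Metric.mem_ball] at hy hz
  have hyz : dist y z < R / 2 := by
    have := dist_triangle_right y z x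
    linarith
  refine le_of_forall_pos_lt_add fun η hη ↦ ?_
  obtain ⟨ℓ, hℓ1, hℓ2⟩ := exists_between (lt_min (lt_add_of_pos_right (dist y z)
    (div_pos hη hC0)) hyz)
  have hedist : riemannianEDist I y z < ENNReal.ofReal ℓ := by
    rw [← IsRiemannianManifold.out (I := I) y z, edist_dist]
    exact (ENNReal.ofReal_lt_ofReal_iff (dist_nonneg.trans_lt hℓ1)).2 hℓ1
  obtain ⟨γ, h0, h1, hγ, hlen, -⟩ :=
    exists_lt_locally_constant_of_riemannianEDist_lt hedist zero_lt_one
  have hmem (t : ℝ) (ht : t ∈ Icc (0 : ℝ) 1) : γ t ∈ Metric.ball x R := by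
    have h : edist y (γ t) < ENNReal.ofReal ℓ := by
      rw [IsRiemannianManifold.out (I := I) y (γ t)]
      exact (riemannianEDist_le_pathELength hγ.contMDiffOn h0 rfl ht.1).trans_lt
        ((pathELength_mono le_rfl ht.2).trans_lt hlen)
    rw [edist_dist, ENNReal.ofReal_lt_ofReal_iff (dist_nonneg.trans_lt hℓ1)] at h
    have h3 := (lt_min_iff.1 hℓ2).2
    have := dist_triangle (γ t) y x
    rw [dist_comm (γ t) y] at this
    rw [Metric.mem_ball]
    linarith
  have key := enorm_extChartAt_sub_le_pathELength I x hγ (fun t ht ↦ (hball (hmem t ht)).2)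
    (fun t ht ↦ by
      rw [enorm_le_coe, ← NNReal.coe_le_coe, coe_nnnorm]
      exact (hball (hmem t ht)).1.le)
  rw [h0, h1] at key
  have key' : ENNReal.ofReal ‖extChartAt I x z - extChartAt I x y‖ ≤ ENNReal.ofReal (C * ℓ) := by
    rw [ofReal_norm, ENNReal.ofReal_mul hC0.le, ENNReal.ofReal_coe_nnreal]
    exact key.trans (by gcongr)
  have hℓ0 : 0 < ℓ := dist_nonneg.trans_lt hℓ1
  rw [ENNReal.ofReal_le_ofReal_iff (by positivity)] at key'
  have hCη : (C : ℝ) * (dist y z + η / C) = C * dist y z + η := by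
    field_simp
  have := mul_lt_mul_of_pos_left (lt_min_iff.1 hℓ2).1 hC0
  linarith

end ChartDistance

section VectorFieldInChart

variable {E : Type*} [NormedAddCommGroup E] [NormedSpace ℝ E] {M : Type*}

/-- The vector field `V` read in the preferred chart at `x₀`. -/
noncomputable def vectorFieldInChart [TopologicalSpace M] [ChartedSpace E M]
    [IsManifold 𝓘(ℝ, E) 1 M]
    (V : (x : M) → TangentSpace 𝓘(ℝ, E) x) (x₀ : M) (z : E) : E :=
  tangentCoordChange 𝓘(ℝ, E) ((extChartAt 𝓘(ℝ, E) x₀).symm z) x₀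
    ((extChartAt 𝓘(ℝ, E) x₀).symm z) (V ((extChartAt 𝓘(ℝ, E) x₀).symm z))

theorem contDiffAt_vectorFieldInChart [TopologicalSpace M] [ChartedSpace E M]
    [IsManifold 𝓘(ℝ, E) 1 M] {V : (x : M) → TangentSpace 𝓘(ℝ, E) x} {x₀ : M}
    (hV : ContMDiffAt 𝓘(ℝ, E) 𝓘(ℝ, E).tangent 1
      (fun x => (⟨x, V x⟩ : TangentBundle 𝓘(ℝ, E) M)) x₀) :
    ContDiffAt ℝ 1 (vectorFieldInChart V x₀) (extChartAt 𝓘(ℝ, E) x₀ x₀) := by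
  rw [contMDiffAt_iff] at hV
  exact (hV.2.contDiffAt (range_mem_nhds_isInteriorPoint
    BoundarylessManifold.isInteriorPoint)).snd

/-- A solution of the equation in the chart yields an integral curve in the manifold. -/
theorem isMIntegralCurveOn_extChartAt_symm_comp [TopologicalSpace M] [ChartedSpace E M]
    [IsManifold 𝓘(ℝ, E) 1 M] {V : (x : M) → TangentSpace 𝓘(ℝ, E) x} {x₀ : M} {f : ℝ → E}
    {s : Set ℝ} (hf : ∀ t ∈ s, HasDerivAt f (vectorFieldInChart V x₀ (f t)) t)
    (hs : ∀ t ∈ s, f t ∈ (extChartAt 𝓘(ℝ, E) x₀).target) :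
    IsMIntegralCurveOn (I := 𝓘(ℝ, E)) ((extChartAt 𝓘(ℝ, E) x₀).symm ∘ f) V s := by
  intro t ht
  let xₜ : M := (extChartAt 𝓘(ℝ, E) x₀).symm (f t)
  have h : HasDerivAt f (tangentCoordChange 𝓘(ℝ, E) xₜ x₀ xₜ (V xₜ)) t := hf t ht
  have hft := hs t ht
  have hft1 : xₜ ∈ (extChartAt 𝓘(ℝ, E) x₀).source := (extChartAt 𝓘(ℝ, E) x₀).map_target hft
  have hft2 := mem_extChartAt_source (I := 𝓘(ℝ, E)) xₜ
  apply HasMFDerivAt.hasMFDerivWithinAt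
  suffices hderiv : HasDerivAt
      ((extChartAt 𝓘(ℝ, E) xₜ ∘ (extChartAt 𝓘(ℝ, E) x₀).symm) ∘ f) (V xₜ : E) t by
    refine ⟨(continuousAt_extChartAt_symm'' hft).comp h.continuousAt, ?_⟩
    rw [show range 𝓘(ℝ, ℝ) = univ by simp]
    exact hderiv.hasFDerivAt.hasFDerivWithinAt
  have hV : tangentCoordChange 𝓘(ℝ, E) x₀ xₜ xₜ (tangentCoordChange 𝓘(ℝ, E) xₜ x₀ xₜ (V xₜ)) =
      V xₜ :=
    (tangentCoordChange_comp ⟨⟨hft2, hft1⟩, hft2⟩).trans (tangentCoordChange_self hft2)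
  have hchart : HasFDerivAt (extChartAt 𝓘(ℝ, E) xₜ ∘ (extChartAt 𝓘(ℝ, E) x₀).symm)
      (tangentCoordChange 𝓘(ℝ, E) x₀ xₜ xₜ) (f t) := by
    apply HasFDerivWithinAt.hasFDerivAt (s := range 𝓘(ℝ, E)) _ (by simp)
    rw [← (extChartAt 𝓘(ℝ, E) x₀).right_inv hft]
    exact hasFDerivWithinAt_tangentCoordChange ⟨hft1, hft2⟩
  exact (hchart.comp_hasDerivAt t h).congr_deriv hV

variable [MetricSpace M] [ChartedSpace E M] [IsManifold 𝓘(ℝ, E) 1 M]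
  [RiemannianBundle (fun x : M => TangentSpace 𝓘(ℝ, E) x)]
  [IsContinuousRiemannianBundle E (fun x : M => TangentSpace 𝓘(ℝ, E) x)]

theorem eventually_norm_le_norm_vectorFieldInChart (V : (x : M) → TangentSpace 𝓘(ℝ, E) x)
    (x₀ : M) : ∃ C > (0 : ℝ), ∀ᶠ p in 𝓝 x₀,
      ‖V p‖ ≤ C * ‖vectorFieldInChart V x₀ (extChartAt 𝓘(ℝ, E) x₀ p)‖ := by
  obtain ⟨C, hC, h⟩ := eventually_norm_symmL_trivializationAt_lt E
    (fun x : M => TangentSpace 𝓘(ℝ, E) x) x₀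
  refine ⟨C, hC, ?_⟩
  filter_upwards [h, chart_source_mem_nhds E x₀] with p hp hsrc
  have hbase : p ∈ (trivializationAt E (fun x : M => TangentSpace 𝓘(ℝ, E) x) x₀).baseSet := by
    simpa using hsrc
  have h1 : (trivializationAt E (fun x : M => TangentSpace 𝓘(ℝ, E) x) x₀).symmL ℝ p
      ((trivializationAt E (fun x : M => TangentSpace 𝓘(ℝ, E) x) x₀).continuousLinearMapAt ℝ p
        (V p)) = V p :=
    Trivialization.symmL_continuousLinearMapAt _ hbase _
  have h2 : (trivializationAt E (fun x : M => TangentSpace 𝓘(ℝ, E) x) x₀).continuousLinearMapAt ℝ p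
        (V p) = vectorFieldInChart V x₀ (extChartAt 𝓘(ℝ, E) x₀ p) := by
    rw [TangentBundle.continuousLinearMapAt_trivializationAt_eq_core hsrc, vectorFieldInChart,
      (extChartAt 𝓘(ℝ, E) x₀).left_inv (by simpa using hsrc)]
    rfl
  rw [h2] at h1
  rw [← h1]
  exact (ContinuousLinearMap.le_opNorm _ _).trans (by gcongr)

/-- Local integral curves exist for a uniform time near every point, and their displacement is
bounded below by the elapsed time multiplied by the initial speed. -/
theorem exists_eventually_isMIntegralCurveOn_displacement [CompleteSpace E]
    [IsRiemannianManifold 𝓘(ℝ, E) M] {V : (x : M) → TangentSpace 𝓘(ℝ, E) x} {x₀ : M}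
    (hV : ContMDiffAt 𝓘(ℝ, E) 𝓘(ℝ, E).tangent 1
      (fun x => (⟨x, V x⟩ : TangentBundle 𝓘(ℝ, E) M)) x₀) :
    ∃ C > (0 : ℝ), ∃ τ > (0 : ℝ), ∀ᶠ p in 𝓝 x₀, ‖V p‖ ≤ C ∧ ∃ γ : ℝ → M, γ 0 = p ∧
      IsMIntegralCurveOn (I := 𝓘(ℝ, E)) γ V (Ioo (-τ) τ) ∧
      ∀ t ∈ Ioo (-τ) τ, |t| * ‖V p‖ ≤ C * dist p (γ t) := by
  set φ := extChartAt 𝓘(ℝ, E) x₀ with hφ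
  obtain ⟨C₁, hC₁, h₁⟩ := eventually_norm_le_norm_vectorFieldInChart V x₀
  obtain ⟨C₂, hC₂, ρ, hρ, h₂⟩ := exists_ball_norm_extChartAt_sub_le_dist 𝓘(ℝ, E) x₀
  have hW := contDiffAt_vectorFieldInChart hV
  have hS : φ.target ∩ φ.symm ⁻¹' Metric.ball x₀ ρ ∈ 𝓝 (φ x₀) :=
    Filter.inter_mem (extChartAt_target_mem_nhds x₀)
      (extChartAt_preimage_mem_nhds (Metric.ball_mem_nhds x₀ hρ))
  obtain ⟨r, hr, τ, hτ, h₃⟩ := hW.exists_forall_ball_exists_hasDerivAt_displacement hS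
  have hcont : ContinuousAt (fun p ↦ ‖vectorFieldInChart V x₀ (φ p)‖) x₀ :=
    (ContinuousAt.comp (f := φ) hW.continuousAt (continuousAt_extChartAt x₀)).norm
  set B := ‖vectorFieldInChart V x₀ (φ x₀)‖ + 1
  have hbound : ∀ᶠ p in 𝓝 x₀, ‖vectorFieldInChart V x₀ (φ p)‖ < B :=
    hcont.eventually_lt_const (lt_add_one _)
  refine ⟨C₁ * B + 2 * C₁ * C₂, by positivity, τ, hτ, ?_⟩
  filter_upwards [h₁, hbound, Metric.ball_mem_nhds x₀ hρ,
    extChartAt_source_mem_nhds (I := 𝓘(ℝ, E)) x₀,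
    (continuousAt_extChartAt (I := 𝓘(ℝ, E)) x₀).preimage_mem_nhds (Metric.ball_mem_nhds _ hr)]
    with p hp hpB hpρ hpsrc hpr
  refine ⟨?_, ?_⟩
  · have : C₁ * ‖vectorFieldInChart V x₀ (φ p)‖ ≤ C₁ * B := by gcongr
    have : 0 ≤ 2 * C₁ * C₂ := by positivity
    linarith
  obtain ⟨f, hf0, hf⟩ := h₃ _ hpr
  have hγ0 : (φ.symm ∘ f) 0 = p := by
    rw [Function.comp_apply, hf0, φ.left_inv hpsrc]
  refine ⟨φ.symm ∘ f, hγ0, isMIntegralCurveOn_extChartAt_symm_comp (fun t ht ↦ (hf t ht).1)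
    (fun t ht ↦ (hf t ht).2.1.1), fun t ht ↦ ?_⟩
  obtain ⟨-, ⟨htgt, hball⟩, hdisp⟩ := hf t ht
  have h := h₂ p hpρ _ hball
  rw [φ.right_inv htgt] at h
  calc |t| * ‖V p‖ ≤ |t| * (C₁ * ‖vectorFieldInChart V x₀ (φ p)‖) := by gcongr
    _ = C₁ * (|t| * ‖vectorFieldInChart V x₀ (φ p)‖) := by ring
    _ ≤ C₁ * (2 * (C₂ * dist p (φ.symm (f t)))) := by
      exact mul_le_mul_of_nonneg_left (hdisp.trans (by gcongr)) hC₁.le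
    _ = 2 * C₁ * C₂ * dist p (φ.symm (f t)) := by ring
    _ ≤ (C₁ * B + 2 * C₁ * C₂) * dist p (φ.symm (f t)) := by
      gcongr
      have : 0 ≤ C₁ * B := by positivity
      linarith

end VectorFieldInChart

section CompactManifold

variable {E : Type*} [NormedAddCommGroup E] [NormedSpace ℝ E] {M : Type*}

/-- On a compact Riemannian manifold the constants of
`exists_eventually_isMIntegralCurveOn_displacement` may be chosen uniformly. -/
theorem exists_forall_isMIntegralCurveOn_displacement [CompleteSpace E]
    [MetricSpace M] [CompactSpace M] [ChartedSpace E M] [IsManifold 𝓘(ℝ, E) 1 M]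
    [RiemannianBundle (fun x : M => TangentSpace 𝓘(ℝ, E) x)]
    [IsContinuousRiemannianBundle E (fun x : M => TangentSpace 𝓘(ℝ, E) x)]
    [IsRiemannianManifold 𝓘(ℝ, E) M] {V : (x : M) → TangentSpace 𝓘(ℝ, E) x}
    (hV : ContMDiff 𝓘(ℝ, E) 𝓘(ℝ, E).tangent 1
      (fun x => (⟨x, V x⟩ : TangentBundle 𝓘(ℝ, E) M))) :
    ∃ C > (0 : ℝ), ∃ τ > (0 : ℝ), ∀ p, ‖V p‖ ≤ C ∧ ∃ γ : ℝ → M, γ 0 = p ∧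
      IsMIntegralCurveOn (I := 𝓘(ℝ, E)) γ V (Ioo (-τ) τ) ∧
      ∀ t ∈ Ioo (-τ) τ, |t| * ‖V p‖ ≤ C * dist p (γ t) := by
  have key := isCompact_univ.induction_on (X := M)
    (p := fun S ↦ ∃ C > (0 : ℝ), ∃ τ > (0 : ℝ), ∀ p ∈ S, ‖V p‖ ≤ C ∧ ∃ γ : ℝ → M, γ 0 = p ∧
      IsMIntegralCurveOn (I := 𝓘(ℝ, E)) γ V (Ioo (-τ) τ) ∧
      ∀ t ∈ Ioo (-τ) τ, |t| * ‖V p‖ ≤ C * dist p (γ t))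
  have mono {C C' τ τ' : ℝ} (hC : C ≤ C') (hτ : τ' ≤ τ) {p : M} (h : ‖V p‖ ≤ C ∧
      ∃ γ : ℝ → M, γ 0 = p ∧ IsMIntegralCurveOn (I := 𝓘(ℝ, E)) γ V (Ioo (-τ) τ) ∧
      ∀ t ∈ Ioo (-τ) τ, |t| * ‖V p‖ ≤ C * dist p (γ t)) : ‖V p‖ ≤ C' ∧
      ∃ γ : ℝ → M, γ 0 = p ∧ IsMIntegralCurveOn (I := 𝓘(ℝ, E)) γ V (Ioo (-τ') τ') ∧
      ∀ t ∈ Ioo (-τ') τ', |t| * ‖V p‖ ≤ C' * dist p (γ t) := by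
    obtain ⟨h1, γ, h2, h3, h4⟩ := h
    have hsub : Ioo (-τ') τ' ⊆ Ioo (-τ) τ := Ioo_subset_Ioo (neg_le_neg hτ) hτ
    exact ⟨h1.trans hC, γ, h2, h3.mono hsub, fun t ht ↦ (h4 t (hsub ht)).trans (by gcongr)⟩
  simp only [mem_univ, forall_true_left] at key
  refine key ⟨1, one_pos, 1, one_pos, by simp⟩ ?_ ?_ ?_
  · rintro S T hST ⟨C, hC, τ, hτ, h⟩
    exact ⟨C, hC, τ, hτ, fun p hp ↦ h p (hST hp)⟩
  · rintro S T ⟨C, hC, τ, hτ, h⟩ ⟨C', hC', τ', hτ', h'⟩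
    refine ⟨max C C', lt_max_of_lt_left hC, min τ τ', lt_min hτ hτ', ?_⟩
    rintro p (hp | hp)
    · exact mono (le_max_left _ _) (min_le_left _ _) (h p hp)
    · exact mono (le_max_right _ _) (min_le_right _ _) (h' p hp)
  · intro x
    obtain ⟨C, hC, τ, hτ, h⟩ := exists_eventually_isMIntegralCurveOn_displacement (hV x)
    exact ⟨_, mem_nhdsWithin_of_mem_nhds h, C, hC, τ, hτ, fun p hp ↦ hp⟩

theorem vectorFieldFlow_spec [TopologicalSpace M] [ChartedSpace E M]
    {V : (x : M) → TangentSpace 𝓘(ℝ, E) x} {x : M}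
    (h : ∃ γ : ℝ → M, γ 0 = x ∧ IsMIntegralCurve (I := 𝓘(ℝ, E)) γ V) :
    vectorFieldFlow V 0 x = x ∧
      IsMIntegralCurve (I := 𝓘(ℝ, E)) (fun t ↦ vectorFieldFlow V t x) V := by
  have heq : (fun t ↦ vectorFieldFlow V t x) = h.choose := by
    funext t
    rw [vectorFieldFlow, dif_pos h]
  exact ⟨(congrFun heq 0).trans h.choose_spec.1, heq ▸ h.choose_spec.2⟩

theorem vectorFieldFlow_eq_of_isMIntegralCurve [TopologicalSpace M] [T2Space M]
    [ChartedSpace E M] [IsManifold 𝓘(ℝ, E) 1 M] {V : (x : M) → TangentSpace 𝓘(ℝ, E) x}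
    (hV : ContMDiff 𝓘(ℝ, E) 𝓘(ℝ, E).tangent 1
      (fun x => (⟨x, V x⟩ : TangentBundle 𝓘(ℝ, E) M)))
    {γ : ℝ → M} (hγ : IsMIntegralCurve (I := 𝓘(ℝ, E)) γ V) (t : ℝ) :
    vectorFieldFlow V t (γ 0) = γ t := by
  obtain ⟨h1, h2⟩ := vectorFieldFlow_spec (V := V) ⟨γ, rfl, hγ⟩
  exact congrFun (isMIntegralCurve_Ioo_eq_of_contMDiff_boundaryless (t₀ := 0) hV h2 hγ h1) t

theorem vectorFieldFlow_add [TopologicalSpace M] [T2Space M]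
    [ChartedSpace E M] [IsManifold 𝓘(ℝ, E) 1 M] {V : (x : M) → TangentSpace 𝓘(ℝ, E) x}
    (hV : ContMDiff 𝓘(ℝ, E) 𝓘(ℝ, E).tangent 1
      (fun x => (⟨x, V x⟩ : TangentBundle 𝓘(ℝ, E) M))) {x : M}
    (h : ∃ γ : ℝ → M, γ 0 = x ∧ IsMIntegralCurve (I := 𝓘(ℝ, E)) γ V) (t s : ℝ) :
    vectorFieldFlow V (t + s) x = vectorFieldFlow V t (vectorFieldFlow V s x) := by
  have := vectorFieldFlow_eq_of_isMIntegralCurve hV ((vectorFieldFlow_spec h).2.comp_add s) t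
  simpa using this.symm

/-- On a compact Riemannian manifold, a `C^1` vector field has bounded speed, its integral curves
are defined for all times, and for short times the flow displaces points by at least a fixed
multiple of the elapsed time multiplied by the initial speed. -/
theorem exists_vectorFieldFlow_displacement [CompleteSpace E]
    [MetricSpace M] [CompactSpace M] [ChartedSpace E M] [IsManifold 𝓘(ℝ, E) 1 M]
    [RiemannianBundle (fun x : M => TangentSpace 𝓘(ℝ, E) x)]
    [IsContinuousRiemannianBundle E (fun x : M => TangentSpace 𝓘(ℝ, E) x)]
    [IsRiemannianManifold 𝓘(ℝ, E) M] {V : (x : M) → TangentSpace 𝓘(ℝ, E) x}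
    (hV : ContMDiff 𝓘(ℝ, E) 𝓘(ℝ, E).tangent 1
      (fun x => (⟨x, V x⟩ : TangentBundle 𝓘(ℝ, E) M))) :
    (∀ x, ∃ γ : ℝ → M, γ 0 = x ∧ IsMIntegralCurve (I := 𝓘(ℝ, E)) γ V) ∧
    ∃ C > (0 : ℝ), ∃ τ > (0 : ℝ), ∀ p, ‖V p‖ ≤ C ∧
      ∀ t : ℝ, |t| < τ → |t| * ‖V p‖ ≤ C * dist p (vectorFieldFlow V t p) := by
  obtain ⟨C, hC, τ, hτ, h⟩ := exists_forall_isMIntegralCurveOn_displacement hV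
  have hglobal : ∀ x, ∃ γ : ℝ → M, γ 0 = x ∧ IsMIntegralCurve (I := 𝓘(ℝ, E)) γ V :=
    exists_isMIntegralCurve_of_isMIntegralCurveOn hV hτ fun x ↦ by
      obtain ⟨-, γ, h0, hγ, -⟩ := h x
      exact ⟨γ, h0, hγ⟩
  refine ⟨hglobal, C, hC, τ, hτ, fun p ↦ ⟨(h p).1, fun t ht ↦ ?_⟩⟩
  obtain ⟨-, γ, h0, hγ, hdisp⟩ := h p
  obtain ⟨hf0, hf⟩ := vectorFieldFlow_spec (hglobal p)
  have heq := isMIntegralCurveOn_Ioo_eqOn_of_contMDiff_boundaryless (t₀ := 0)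
    ⟨neg_lt_zero.2 hτ, hτ⟩ hV (hf.isMIntegralCurveOn (Ioo (-τ) τ)) hγ (hf0.trans h0.symm)
  have ht' := abs_lt.1 ht
  rw [show vectorFieldFlow V t p = γ t from heq ht']
  exact hdisp t ht'

end CompactManifold

/-- On a closed Riemannian manifold, a `C^1` vector field that is k*-expansive on a compact
invariant set is rescaling expansive on it. -/
theorem theorem1 {E : Type*} [NormedAddCommGroup E] [NormedSpace ℝ E] [FiniteDimensional ℝ E]
    {M : Type*} [MetricSpace M] [ChartedSpace E M] [IsManifold 𝓘(ℝ, E) ∞ M]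
    [RiemannianBundle (fun x : M => TangentSpace 𝓘(ℝ, E) x)]
    [IsContMDiffRiemannianBundle 𝓘(ℝ, E) ∞ E (fun x : M => TangentSpace 𝓘(ℝ, E) x)]
    [IsRiemannianManifold 𝓘(ℝ, E) M]
    [CompactSpace M] [ConnectedSpace M]
    (V : (x : M) → TangentSpace 𝓘(ℝ, E) x)
    (hV : ContMDiff 𝓘(ℝ, E) 𝓘(ℝ, E).tangent 1 (fun x => (⟨x, V x⟩ : TangentBundle 𝓘(ℝ, E) M)))
    (Λ : Set M) (hΛc : IsCompact Λ) (hΛi : IsFlowInvariant V Λ)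
    (hk : KStarExpansiveOn V Λ) :
    RescalingExpansiveOn V Λ := by
  have : CompleteSpace E := FiniteDimensional.complete ℝ E
  have : IsManifold 𝓘(ℝ, E) 1 M := .of_le (n := ∞) (by norm_cast)
  have : IsContinuousRiemannianBundle E (fun x : M => TangentSpace 𝓘(ℝ, E) x) := by
    obtain ⟨g, hg, hinner⟩ := IsContMDiffRiemannianBundle.exists_contMDiff (IB := 𝓘(ℝ, E))
      (n := ∞) (F := E) (E := fun x : M => TangentSpace 𝓘(ℝ, E) x)
    exact ⟨g, hg.continuous, hinner⟩
  obtain ⟨hglobal, C, hC, τ, hτ, h⟩ := exists_vectorFieldFlow_displacement hV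
  have hadd (t s : ℝ) (x : M) := vectorFieldFlow_add hV (hglobal x) t s
  have hzero (x : M) := (vectorFieldFlow_spec (hglobal x)).1
  intro ε hε
  obtain ⟨δ₀, hδ₀, hk⟩ := hk (τ / 2) (by positivity)
  obtain ⟨δ, hδ, hδC⟩ : ∃ δ > 0, C * δ < min δ₀ (min ε τ) := by
    obtain ⟨η, hη, hη'⟩ := exists_between (lt_min hδ₀ (lt_min hε hτ))
    exact ⟨η / C, by positivity, by rwa [mul_div_cancel₀ _ hC.ne']⟩
  simp only [lt_min_iff] at hδC
  obtain ⟨hδ1, hδ2, hδ3⟩ := hδC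
  refine ⟨δ, hδ, fun x hx y hy s hs hd ↦ ?_⟩
  by_cases hVx : V x = 0
  · have h0 := hd 0
    rw [hzero, hVx, norm_zero, mul_zero] at h0
    exact ⟨0, ⟨by linarith, hε.le⟩, (hzero x).trans (dist_le_zero.1 h0)⟩
  have hreg (t : ℝ) : 0 < ‖V (vectorFieldFlow V t x)‖ := by
    rw [norm_pos_iff]
    intro hVt
    have h1 := isMIntegralCurve_Ioo_eq_of_contMDiff_boundaryless (t₀ := t) hV
      (vectorFieldFlow_spec (hglobal x)).2 (isMIntegralCurve_const hVt) rfl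
    have h2 : x = vectorFieldFlow V t x := (hzero x).symm.trans (congrFun h1 0)
    rw [← h2] at hVt
    exact hVx hVt
  let s' : ℝ ≃ₜ ℝ := s.trans (Homeomorph.addRight (-s 0))
  have hs' (t : ℝ) : s' t = s t - s 0 := (sub_eq_add_neg _ _).symm
  have hflow (t : ℝ) : vectorFieldFlow V (s' t) (vectorFieldFlow V (s 0) y) =
      vectorFieldFlow V (s t) y := by
    rw [← hadd, hs', sub_add_cancel]
  obtain ⟨t₀, r, ⟨hr1, hr2⟩, hr⟩ := hk x hx (vectorFieldFlow V (s 0) y)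
    (hΛi (s 0) ▸ mem_image_of_mem _ hy) s' (fun a b hab ↦ by rw [hs', hs']; linarith [hs hab])
    (by rw [hs', sub_self]) (fun t ↦ by
      rw [hflow]
      have := mul_le_mul_of_nonneg_left (h (vectorFieldFlow V t x)).1 hδ.le
      linarith [hd t])
  rw [hflow] at hr
  let u : ℝ → ℝ := fun t ↦ s t - s t₀ + r - t
  have hu : Continuous u := by fun_prop
  have hyu (t : ℝ) : vectorFieldFlow V (u t) (vectorFieldFlow V t x) =
      vectorFieldFlow V (s t) y := by
    calc vectorFieldFlow V (u t) (vectorFieldFlow V t x)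
        = vectorFieldFlow V ((s t - s t₀) + r) x := by rw [← hadd]; congr 1; ring
      _ = vectorFieldFlow V (s t) y := by
        rw [hadd, show vectorFieldFlow V r x = _ from hr, ← hadd, sub_add_cancel]
  have hsmall (t : ℝ) (ht : |u t| < τ) : |u t| ≤ C * δ := by
    have h1 := (h (vectorFieldFlow V t x)).2 (u t) ht
    rw [hyu] at h1
    have h2 := mul_le_mul_of_nonneg_left (hd t) hC.le
    refine le_of_mul_le_mul_right ?_ (hreg t)
    linarith
  have hset : {t | |u t| < τ} = {t | |u t| ≤ C * δ} :=
    Subset.antisymm hsmall fun t ht ↦ lt_of_le_of_lt ht hδ3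
  have hclopen : IsClopen {t | |u t| < τ} :=
    ⟨hset ▸ isClosed_le hu.abs continuous_const, isOpen_lt hu.abs continuous_const⟩
  have huniv := hclopen.eq_univ ⟨t₀, show |u t₀| < τ by
    rw [show u t₀ = r - t₀ by simp [u], abs_lt]
    constructor <;> linarith⟩
  have h0 : |u 0| ≤ ε := (hsmall 0 (huniv ▸ mem_univ (0 : ℝ) : (0 : ℝ) ∈ {t | |u t| < τ})).trans
    hδ2.le
  refine ⟨u 0, abs_le.1 h0, ?_⟩
  have := hyu 0
  rwa [hzero] at this
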